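/- Let $A$ be a separable C*-algebra (not necessarily unital). An irreducible representation of $A$ is a nonzero $*$-homomorphism $\rho\colon A\to B(H)$, $H$ a complex Hilbert space, without closed invariant subspaces other than $0$ and $H$. Let $\mathrm{Prim}(A)$ be the set of kernels of irreducible representations of $A$, with the Jacobson topology, whose closed sets are the sets $\{t\in \mathrm{Prim}(A): I\subseteq t\}$ for $I$ a closed two-sided ideal of $A$. Order and rank of a function. Let $X$ be a topological space and $w\colon X\to\mathbb N\cup\{\infty\}$ a function. Define subsets $X_\alpha\subseteq X$ by recursion on the ordinal $\alpha$: $x\in X_\alpha$ if and only if $x$ has a neighborhood $U$ such that $w$ is bounded by a natural number on $U\setminus\bigcup_{\beta<\alpha}X_\beta$. The order $o_w(x)$ is the least $\alpha$ with $x\in X_\alpha$, and $o_w(x)=\infty$ if there is none (in particular if $w(x)=\infty$). The rank of $x$ is $r_w(x)=\omega\, o_w(x)+w(x)$ (ordinal arithmetic) if $o_w(x)<\infty$, and $r_w(x)=\infty$ otherwise. The rank of $w$ is $r(w)=\sup_{x\in X}r_w(x)$. For $a\in A$ let $w_a\colon \mathrm{Prim}(A)\to\mathbb N\cup\{\infty\}$,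 $\mathrm{Ker}(\rho)\mapsto\mathrm{rank}(\rho(a))$. The Pedersen rank of $a$ is $r(w_a)$. A local section is a pair $(b,U)$ with $b\in A$ and $U\subseteq\mathrm{Prim}(A)$ open such that $\rho(b)\neq0$ for every irreducible representation $\rho$ with $\mathrm{Ker}(\rho)\in U$; its Fell rank is $r(w_b|_U)$, computed on $U$ with the subspace topology. The Fell rank of an irreducible representation $\pi$ is the least of the Fell ranks of the local sections $(b,U)$ with $\mathrm{Ker}(\pi)\in U$. Let $\pi$ be an irreducible representation of $A$ and let $\alpha<\omega_1$ be an ordinal. Then the following assertions are equivalent: 1. the Fell rank of $\pi$ is at most $\alpha$; 2. there exists $a\in A$ of Pedersen rank at most $\alpha$ such that $\pi(a)\neq0$. -/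

import Mathlib

universe u v

noncomputable section

namespace FellPedersen

open scoped Topology

/-! ## Order and rank of a function with values in `ℕ ∪ {∞}` -/

section Weight

variable {X : Type u} [TopologicalSpace X]

/-- The set `X_α` of points of order at most `α` with respect to `w`: a point `x` belongs to it if,
on some neighbourhood of `x`, the function `w` is bounded by a natural number outside
the set of points of order `< α`. For `α = 0`: `w` is bounded on a neighbourhood of `x`. -/
def orderLE (w : X → ℕ∞) (α : Ordinal.{u}) : Set X :=
  {x | ∃ U ∈ 𝓝 x, ∃ n : ℕ, ∀ y ∈ U, (∃ β, ∃ _ : β < α, y ∈ orderLE w β) ∨ w y ≤ n}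
termination_by α

/-- The order `o_w(x)`: the least `α` with `x ∈ X_α`, and `⊤` if there is none (in particular if
`w x = ∞`). -/
def orderAt (w : X → ℕ∞) (x : X) : WithTop Ordinal.{u} :=
  sInf ((↑) '' {α : Ordinal.{u} | x ∈ orderLE w α})

/-- The rank `r_w(x) = ω · o_w(x) + w(x)`, and `⊤` if `o_w(x) = ⊤`. (If `o_w(x)` is an ordinal,
then `w x` is finite, so `toNat` loses nothing.) -/
def rankAt (w : X → ℕ∞) (x : X) : WithTop Ordinal.{u} :=
  (orderAt w x).map fun α => Ordinal.omega0 * α + ((w x).toNat : Ordinal.{u})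

/-- The rank `r(w)` of `w`: the supremum of the ranks of the points. -/
def rank (w : X → ℕ∞) : WithTop Ordinal.{u} := ⨆ x, rankAt w x

theorem mem_orderLE {w : X → ℕ∞} {α : Ordinal.{u}} {x : X} :
    x ∈ orderLE w α ↔ ∃ U ∈ 𝓝 x, ∃ n : ℕ, ∀ y ∈ U, (∃ β < α, y ∈ orderLE w β) ∨ w y ≤ n := by
  rw [orderLE]; simp

theorem orderLE_mono (w : X → ℕ∞) {α β : Ordinal.{u}} (h : α ≤ β) :
    orderLE w α ⊆ orderLE w β := by
  intro x hx
  rw [mem_orderLE] at hx ⊢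
  obtain ⟨U, hU, n, hn⟩ := hx
  refine ⟨U, hU, n, fun y hy => (hn y hy).imp_left ?_⟩
  rintro ⟨γ, hγ, hy⟩
  exact ⟨γ, hγ.trans_le h, hy⟩

theorem orderAt_le_iff {w : X → ℕ∞} {x : X} {α : Ordinal.{u}} :
    orderAt w x ≤ α ↔ x ∈ orderLE w α := by
  constructor
  · intro h
    by_cases hne : {α : Ordinal.{u} | x ∈ orderLE w α}.Nonempty
    · have hm : sInf {α : Ordinal.{u} | x ∈ orderLE w α} ∈ _ := csInf_mem hne
      have h2 := WithTop.coe_sInf' hne (OrderBot.bddBelow _)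
      rw [orderAt, ← h2, WithTop.coe_le_coe] at h
      exact orderLE_mono w h hm
    · rw [Set.not_nonempty_iff_eq_empty] at hne
      simp [orderAt, hne] at h
  · exact fun h => sInf_le ⟨α, h, rfl⟩

/-- Compatibility with the description of points of order `α`: if all points `y ≠ x` near `x` have
order `< α`, while their ranks exceed any given `β < ω · α` arbitrarily close to `x`, then `x` has
order `α`. -/
theorem orderAt_eq_of_recursion {w : X → ℕ∞} {x : X} {α : Ordinal.{u}} (hx : w x ≠ ⊤)
    (h1 : ∃ U ∈ 𝓝 x, ∀ y ∈ U \ {x}, orderAt w y < α)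
    (h2 : ∀ β < Ordinal.omega0 * α, ∀ W ∈ 𝓝 x, ∃ y ∈ W \ {x},
      (β : WithTop Ordinal.{u}) < rankAt w y) :
    orderAt w x = α := by
  apply le_antisymm
  · rw [orderAt_le_iff, mem_orderLE]
    obtain ⟨U, hU, h⟩ := h1
    obtain ⟨n, hn⟩ := WithTop.ne_top_iff_exists.1 hx
    refine ⟨U, hU, n, fun y hy => ?_⟩
    by_cases hyx : y = x
    · exact .inr (hyx ▸ hn.symm.le)
    · obtain ⟨β, hβ⟩ := WithTop.ne_top_iff_exists.1 (h y ⟨hy, hyx⟩).ne_top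
      exact .inl ⟨β, by simpa [← hβ] using h y ⟨hy, hyx⟩, orderAt_le_iff.1 hβ.symm.le⟩
  · by_contra! hlt
    obtain ⟨β, hβ⟩ := WithTop.ne_top_iff_exists.1 hlt.ne_top
    rw [← hβ, WithTop.coe_lt_coe] at hlt
    obtain ⟨U, hU, n, hn⟩ := mem_orderLE.1 (orderAt_le_iff.1 hβ.symm.le)
    obtain ⟨W, hWU, hWo, hxW⟩ := mem_nhds_iff.1 hU
    have hlt' : Ordinal.omega0 * β + (n : Ordinal.{u}) < Ordinal.omega0 * α := by
      refine lt_of_lt_of_le ?_ (mul_le_mul_right (Order.succ_le_of_lt hlt) Ordinal.omega0)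
      rw [Ordinal.mul_succ]
      exact (add_lt_add_iff_left _).2 (Ordinal.natCast_lt_omega0 n)
    obtain ⟨y, ⟨hyW, -⟩, hy⟩ := h2 _ hlt' W (hWo.mem_nhds hxW)
    have hyβ : orderAt w y ≤ β :=
      orderAt_le_iff.2 (mem_orderLE.2 ⟨W, hWo.mem_nhds hyW, n, fun z hz => hn z (hWU hz)⟩)
    obtain ⟨γ, hγ⟩ := WithTop.ne_top_iff_exists.1 (hyβ.trans_lt (WithTop.coe_lt_top β)).ne
    rw [rankAt, ← hγ, WithTop.map_coe, WithTop.coe_lt_coe] at hy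
    rw [← hγ, WithTop.coe_le_coe] at hyβ
    refine hy.not_ge ?_
    rcases hyβ.lt_or_eq with h | rfl
    · calc Ordinal.omega0 * γ + ((w y).toNat : Ordinal.{u})
          ≤ Ordinal.omega0 * γ + Ordinal.omega0 := by
            gcongr; exact (Ordinal.natCast_lt_omega0 _).le
        _ = Ordinal.omega0 * Order.succ γ := (Ordinal.mul_succ _ _).symm
        _ ≤ Ordinal.omega0 * β := mul_le_mul_right (Order.succ_le_of_lt h) _
        _ ≤ _ := le_self_add
    · have hwy : w y ≤ n := by
        refine (hn y (hWU hyW)).resolve_left ?_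
        rintro ⟨δ, hδ, hyδ⟩
        have := orderAt_le_iff.2 hyδ
        rw [← hγ, WithTop.coe_le_coe] at this
        exact this.not_gt hδ
      gcongr
      exact ENat.toNat_le_of_le_natCast hwy

end Weight

/-! ## Irreducible representations and the primitive spectrum -/

section Spectrum

/-- An irreducible representation of `A`: a nonzero `*`-homomorphism into the bounded operators of
a Hilbert space which leaves no closed subspace invariant except `0` and the whole space. -/
structure IrredRep (A : Type u) [NonUnitalCStarAlgebra A] where
  /-- The Hilbert space of the representation. -/
  H : Type v
  [instNormed : NormedAddCommGroup H]
  [instInner : InnerProductSpace ℂ H]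
  [instComplete : CompleteSpace H]
  /-- The underlying `*`-homomorphism. -/
  toHom : A →⋆ₙₐ[ℂ] (H →L[ℂ] H)
  ne_zero : ∃ a, toHom a ≠ 0
  irreducible : ∀ K : Submodule ℂ H, IsClosed (K : Set H) →
    (∀ a, ∀ ξ ∈ K, toHom a ξ ∈ K) → K = ⊥ ∨ K = ⊤

attribute [instance] IrredRep.instNormed IrredRep.instInner IrredRep.instComplete

variable {A : Type u} [NonUnitalCStarAlgebra A]

namespace IrredRep

/-- The kernel of an irreducible representation, a two-sided ideal. -/
def ker (π : IrredRep.{u, v} A) : TwoSidedIdeal A := TwoSidedIdeal.ker π.toHom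

theorem mem_ker {π : IrredRep.{u, v} A} {a : A} : a ∈ π.ker ↔ π.toHom a = 0 :=
  TwoSidedIdeal.mem_ker _

theorem isClosed_ker (π : IrredRep.{u, v} A) : IsClosed (π.ker : Set A) := by
  have h : (π.ker : Set A) = π.toHom ⁻¹' {0} := by
    ext a
    simp [mem_ker]
  rw [h]
  have hc : Continuous π.toHom :=
    AddMonoidHomClass.continuous_of_bound π.toHom 1 fun a => by
      simpa using NonUnitalStarAlgHom.norm_apply_le π.toHom a
  exact isClosed_singleton.preimage hc

/-- The rank of the operator `π(a)`, in `ℕ ∪ {∞}`. -/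
def opRank (π : IrredRep.{u, v} A) (a : A) : ℕ∞ :=
  Cardinal.toENat (LinearMap.rank (π.toHom a : π.H →ₗ[ℂ] π.H))

/-- Kernels of irreducible representations are prime. -/
theorem le_ker_or_le_ker (π : IrredRep.{u, v} A) {I J : TwoSidedIdeal A} (h : I ⊓ J ≤ π.ker) :
    I ≤ π.ker ∨ J ≤ π.ker := by
  let K : Submodule ℂ π.H := ⨅ x ∈ I, (π.toHom x).ker
  have hK : ∀ ξ, ξ ∈ K ↔ ∀ x ∈ I, π.toHom x ξ = 0 := by simp [K]
  have hc : IsClosed (K : Set π.H) := by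
    have : (K : Set π.H) = ⋂ x ∈ I, ((π.toHom x).ker : Set π.H) := by simp [K]
    rw [this]
    exact isClosed_biInter fun x _ => (π.toHom x).isClosed_ker
  have hi : ∀ a, ∀ ξ ∈ K, π.toHom a ξ ∈ K := by
    intro a ξ hξ
    rw [hK] at hξ ⊢
    intro x hx
    have := hξ (x * a) (I.mul_mem_right _ _ hx)
    rwa [map_mul] at this
  rcases π.irreducible K hc hi with h0 | h0
  · right
    intro y hy
    rw [mem_ker]
    ext ξ
    have : π.toHom y ξ ∈ K := by
      rw [hK]
      intro x hx
      have hxy : x * y ∈ π.ker :=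
        h ((TwoSidedIdeal.mem_inf A).2 ⟨I.mul_mem_right _ _ hx, J.mul_mem_left _ _ hy⟩)
      rw [mem_ker, map_mul] at hxy
      exact congrArg (fun T => T ξ) hxy
    rw [h0] at this
    simpa using this
  · left
    intro x hx
    rw [mem_ker]
    ext ξ
    have : ξ ∈ K := h0 ▸ Submodule.mem_top
    exact (hK ξ).1 this x hx

end IrredRep

variable (A) in
/-- The primitive spectrum of `A`: the kernels of its irreducible representations. The universe `v`
is the one of the Hilbert spaces; if `A` is separable, these spaces are
separable, so that its choice is immaterial. -/
def Prim : Type u := {t : TwoSidedIdeal A // ∃ ρ : IrredRep.{u, v} A, ρ.ker = t}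

/-- The kernel of `π` as a point of the primitive spectrum. -/
def IrredRep.kerPrim (π : IrredRep.{u, v} A) : Prim.{u, v} A := ⟨π.ker, π, rfl⟩

/-- The hull of an ideal: the primitive ideals containing it. -/
def hull (I : TwoSidedIdeal A) : Set (Prim.{u, v} A) := {t | I ≤ t.1}

/-- The Jacobson topology: the closed sets are the hulls of the closed two-sided ideals. -/
instance : TopologicalSpace (Prim.{u, v} A) :=
  TopologicalSpace.ofClosed {C | ∃ I : TwoSidedIdeal A, IsClosed (I : Set A) ∧ C = hull I}
    (by
      refine ⟨⊤, by simp, ?_⟩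
      symm
      rw [Set.eq_empty_iff_forall_notMem]
      rintro ⟨_, ρ, rfl⟩ h
      obtain ⟨a, ha⟩ := ρ.ne_zero
      exact ha (IrredRep.mem_ker.1 (h (TwoSidedIdeal.mem_top A))))
    (by
      intro S hS
      refine ⟨sInf (Subtype.val '' ⋂₀ S), ?_, ?_⟩
      · have : ((sInf (Subtype.val '' ⋂₀ S) : TwoSidedIdeal A) : Set A) =
            ⋂ t ∈ ⋂₀ S, (t.1 : Set A) := by
          ext a
          rw [SetLike.mem_coe, TwoSidedIdeal.mem_sInf]
          simp only [Set.forall_mem_image, Set.mem_iInter, SetLike.mem_coe]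
          exact Iff.rfl
        rw [this]
        refine isClosed_biInter fun t _ => ?_
        obtain ⟨_, ρ, rfl⟩ := t
        exact ρ.isClosed_ker
      · refine Set.Subset.antisymm (fun t ht =>
          show sInf (Subtype.val '' ⋂₀ S) ≤ t.1 from sInf_le (Set.mem_image_of_mem _ ht)) fun t ht C hC => ?_
        obtain ⟨I, -, rfl⟩ := hS hC
        refine le_trans (le_sInf ?_) (show sInf (Subtype.val '' ⋂₀ S) ≤ t.1 from ht)
        rintro _ ⟨s, hs, rfl⟩
        exact hs _ hC)
    (by
      rintro _ ⟨I, hI, rfl⟩ _ ⟨J, hJ, rfl⟩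
      refine ⟨I ⊓ J, ?_, ?_⟩
      · have : ((I ⊓ J : TwoSidedIdeal A) : Set A) = (I : Set A) ∩ J := by
          ext a
          simp [TwoSidedIdeal.mem_inf]
        rw [this]
        exact hI.inter hJ
      · ext ⟨_, ρ, rfl⟩
        exact ⟨fun h => h.elim (fun h => le_trans (b := I) inf_le_left h)
          fun h => le_trans (b := J) inf_le_right h, fun h => ρ.le_ker_or_le_ker h⟩)

/-- The function `w_a : Prim(A) → ℕ ∪ {∞}`, `Ker ρ ↦ rank ρ(a)`. (Irreducible representations with
the same kernel assign the same rank in `ℕ ∪ {∞}` to `a`, so the choice of `ρ` is immaterial.) -/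
def pedersenFun (a : A) (t : Prim.{u, v} A) : ℕ∞ := t.2.choose.opRank a

/-- The Pedersen rank of `a`: the rank of `w_a`. -/
def pedersenRank (a : A) : WithTop Ordinal.{u} := rank (pedersenFun.{u, v} a)

variable (A) in
/-- A local section `(b, U)`: `U` is open in the primitive spectrum and `ρ(b) ≠ 0` whenever
`Ker ρ ∈ U`. -/
structure LocalSection where
  /-- The element of the algebra. -/
  b : A
  /-- The open set. -/
  U : TopologicalSpace.Opens (Prim.{u, v} A)
  ne_zero : ∀ ρ : IrredRep.{u, v} A, ρ.kerPrim ∈ U → ρ.toHom b ≠ 0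

/-- The Fell rank of `(b, U)`: the rank of `Ker ρ ↦ rank ρ(b)` on `U`. -/
def LocalSection.fellRank (s : LocalSection.{u, v} A) : WithTop Ordinal.{u} :=
  rank fun t : s.U => pedersenFun s.b t.1

/-- The Fell rank of `π`: the least Fell rank of a local section `(b, U)` with `Ker π ∈ U`. -/
def IrredRep.fellRank (π : IrredRep.{u, v} A) : WithTop Ordinal.{u} :=
  sInf {r | ∃ s : LocalSection.{u, v} A, π.kerPrim ∈ s.U ∧ s.fellRank = r}

end Spectrum

end FellPedersen

end

/-!
A bound `r(w) ≤ ω γ + n` only says that every point lies in `X_β` for some `β < γ` or satisfies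
`w x ≤ n` (`rank_le_iff`). In this form the bound is visibly preserved when `w` is restricted to an
open set, and when a function on an open set `U` is decreased and then extended by zero
(`rank_le_of_le_on_open`): the points outside `U`, near which `w` may well be unbounded, satisfy
`w x ≤ n` for the trivial reason that `w x = 0`.

Hence, if `a` has Pedersen rank at most `α` and `π(a) ≠ 0`, then `a` together with the open set of
the primitive ideals not containing `a` is a local section witnessing that the Fell rank of `π` is
at most `α`. Conversely, let `(b, U)` be a local section around `Ker π`, and let `I` be the closed
ideal whose hull is the complement of `U`. Since `π` is irreducible and does not vanish on `I`,
there is `x ∈ I` with `π(x b) ≠ 0` (`IrredRep.exists_mul_ne_zero`). The function `w_{xb}` is bounded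
by `w_b` and vanishes outside `U`, so that `x b` has Pedersen rank at most `α`.
-/

noncomputable section

namespace FellPedersen

open scoped Topology

/-! ### Bounds for the rank of a function -/

section Weight

variable {X : Type u} [TopologicalSpace X]

theorem ne_top_of_mem_orderLE {w : X → ℕ∞} {x : X} {α : Ordinal.{u}} (hx : x ∈ orderLE w α) :
    w x ≠ ⊤ := by
  induction α using WellFoundedLT.induction with
  | ind α ih =>
    obtain ⟨U, hU, n, hn⟩ := mem_orderLE.1 hx
    rcases hn x (mem_of_mem_nhds hU) with ⟨β, hβ, h⟩ | h
    · exact ih β hβ h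
    · exact ne_top_of_le_ne_top (ENat.natCast_ne_top n) h

theorem rankAt_le_iff {w : X → ℕ∞} {x : X} {γ : Ordinal.{u}} {n : ℕ} (hx : x ∈ orderLE w γ) :
    rankAt w x ≤ ((Ordinal.omega0 * γ + n : Ordinal.{u}) : WithTop Ordinal.{u}) ↔
      (∃ β < γ, x ∈ orderLE w β) ∨ w x ≤ n := by
  have hγ : orderAt w x ≤ γ := orderAt_le_iff.2 hx
  obtain ⟨o, ho⟩ := WithTop.ne_top_iff_exists.1 (hγ.trans_lt (WithTop.coe_lt_top γ)).ne
  obtain ⟨m, hm⟩ := WithTop.ne_top_iff_exists.1 (ne_top_of_mem_orderLE hx)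
  have hm' : w x = (m : ℕ∞) := hm.symm
  rw [← ho, WithTop.coe_le_coe] at hγ
  rw [rankAt, ← ho, WithTop.map_coe, WithTop.coe_le_coe, hm', ENat.toNat_natCast, Nat.cast_le]
  have hiff : ∀ β, x ∈ orderLE w β ↔ o ≤ β := fun β => by
    rw [← orderAt_le_iff, ← ho, WithTop.coe_le_coe]
  simp only [hiff]
  rcases hγ.lt_or_eq with h | rfl
  · refine iff_of_true ?_ (.inl ⟨o, h, le_rfl⟩)
    calc Ordinal.omega0 * o + (m : Ordinal.{u})
        ≤ Ordinal.omega0 * o + Ordinal.omega0 := by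
          gcongr; exact (Ordinal.natCast_lt_omega0 _).le
      _ = Ordinal.omega0 * Order.succ o := (Ordinal.mul_succ _ _).symm
      _ ≤ Ordinal.omega0 * γ := mul_le_mul_right (Order.succ_le_of_lt h) _
      _ ≤ _ := le_self_add
  · rw [add_le_add_iff_left, Nat.cast_le]
    refine ⟨.inr, fun h => h.resolve_left ?_⟩
    rintro ⟨β, hβ, h⟩
    exact h.not_gt hβ

/-- The rank is at most `ω γ + n` if and only if the function is at most `n` at the points which are
not of order `< γ`. No local condition has to be added on the right: a bound by `n` at all these
points makes every point of order at most `γ`. -/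
theorem rank_le_iff {w : X → ℕ∞} {γ : Ordinal.{u}} {n : ℕ} :
    rank w ≤ ((Ordinal.omega0 * γ + n : Ordinal.{u}) : WithTop Ordinal.{u}) ↔
      ∀ x, (∃ β < γ, x ∈ orderLE w β) ∨ w x ≤ n := by
  rw [rank, iSup_le_iff]
  constructor
  · intro h x
    refine (rankAt_le_iff ?_).1 (h x)
    have hx := h x
    rw [← orderAt_le_iff]
    by_contra! hlt
    cases ho : orderAt w x with
    | top =>
      rw [rankAt, ho] at hx
      exact (WithTop.coe_lt_top _).not_ge hx
    | coe o =>
      rw [ho, WithTop.coe_lt_coe] at hlt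
      rw [rankAt, ho, WithTop.map_coe, WithTop.coe_le_coe] at hx
      refine hx.not_gt ?_
      calc Ordinal.omega0 * γ + (n : Ordinal.{u})
          < Ordinal.omega0 * γ + Ordinal.omega0 :=
            (add_lt_add_iff_left _).2 (Ordinal.natCast_lt_omega0 n)
        _ = Ordinal.omega0 * Order.succ γ := (Ordinal.mul_succ _ _).symm
        _ ≤ Ordinal.omega0 * o := mul_le_mul_right (Order.succ_le_of_lt hlt) _
        _ ≤ _ := le_self_add
  · exact fun h x => (rankAt_le_iff
      (mem_orderLE.2 ⟨Set.univ, Filter.univ_mem, n, fun y _ => h y⟩)).2 (h x)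

theorem exists_eq_omega0_mul_add (α : Ordinal.{u}) :
    ∃ (γ : Ordinal.{u}) (n : ℕ), α = Ordinal.omega0 * γ + n := by
  obtain ⟨n, hn⟩ := Ordinal.lt_omega0.1 (Ordinal.mod_lt α Ordinal.omega0_ne_zero)
  exact ⟨α / Ordinal.omega0, n, by rw [← hn, Ordinal.div_add_mod]⟩

theorem orderLE_comp {Y : Type u} [TopologicalSpace Y] {f : Y → X} (hf : Continuous f)
    {w : X → ℕ∞} {α : Ordinal.{u}} {y : Y} (hy : f y ∈ orderLE w α) :
    y ∈ orderLE (w ∘ f) α := by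
  induction α using WellFoundedLT.induction generalizing y with
  | ind α ih =>
    obtain ⟨U, hU, n, hn⟩ := mem_orderLE.1 hy
    refine mem_orderLE.2 ⟨f ⁻¹' U, hf.continuousAt hU, n, fun z hz => (hn _ hz).imp_left ?_⟩
    rintro ⟨β, hβ, h⟩
    exact ⟨β, hβ, ih β hβ h⟩

theorem rank_comp_le {Y : Type u} [TopologicalSpace Y] {f : Y → X} (hf : Continuous f)
    {w : X → ℕ∞} {α : Ordinal.{u}} (h : rank w ≤ α) : rank (w ∘ f) ≤ α := by
  obtain ⟨γ, n, rfl⟩ := exists_eq_omega0_mul_add α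
  refine rank_le_iff.2 fun y => (rank_le_iff.1 h (f y)).imp_left ?_
  rintro ⟨β, hβ, hy⟩
  exact ⟨β, hβ, orderLE_comp hf hy⟩

theorem mem_orderLE_of_le_on_open {U : Set X} (hU : IsOpen U) {v w : X → ℕ∞}
    (hvw : ∀ x ∈ U, v x ≤ w x) {α : Ordinal.{u}} {x : U}
    (hx : x ∈ orderLE (fun y : U => w y) α) : (x : X) ∈ orderLE v α := by
  induction α using WellFoundedLT.induction generalizing x with
  | ind α ih =>
    obtain ⟨V, hV, n, hn⟩ := mem_orderLE.1 hx
    refine mem_orderLE.2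
      ⟨Subtype.val '' V, hU.isOpenEmbedding_subtypeVal.image_mem_nhds.2 hV, n, ?_⟩
    rintro _ ⟨y, hy, rfl⟩
    refine (hn y hy).imp ?_ (hvw y y.2).trans
    rintro ⟨β, hβ, h⟩
    exact ⟨β, hβ, ih β hβ h⟩

/-- If `v ≤ w` on an open set `U` and `v` vanishes outside `U`, then bounds for the rank of `w` on
`U` hold for the rank of `v` on the whole space. -/
theorem rank_le_of_le_on_open {U : Set X} (hU : IsOpen U) {v w : X → ℕ∞}
    (hvw : ∀ x ∈ U, v x ≤ w x) (hv : ∀ x ∉ U, v x = 0) {α : Ordinal.{u}}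
    (h : rank (fun y : U => w y) ≤ α) : rank v ≤ α := by
  obtain ⟨γ, n, rfl⟩ := exists_eq_omega0_mul_add α
  refine rank_le_iff.2 fun x => ?_
  by_cases hx : x ∈ U
  · refine (rank_le_iff.1 h ⟨x, hx⟩).imp ?_ (hvw x hx).trans
    rintro ⟨β, hβ, hy⟩
    exact ⟨β, hβ, mem_orderLE_of_le_on_open hU hvw hy⟩
  · exact .inr (by simp [hv x hx])

end Weight

/-! ### Ideals and irreducible representations -/

section Spectrum

variable {A : Type u} [NonUnitalCStarAlgebra A]

theorem isClosed_prim_iff {C : Set (Prim.{u, v} A)} :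
    IsClosed C ↔ ∃ I : TwoSidedIdeal A, IsClosed (I : Set A) ∧ C = hull I := by
  rw [← isOpen_compl_iff]
  change Cᶜᶜ ∈ {C | ∃ I : TwoSidedIdeal A, IsClosed (I : Set A) ∧ C = hull I} ↔ _
  rw [compl_compl]
  rfl

theorem isClosed_setOf_mem_prim (a : A) : IsClosed {t : Prim.{u, v} A | a ∈ t.1} := by
  -- The intersection of the primitive ideals containing `a` has the same hull as `a`.
  refine isClosed_prim_iff.2 ⟨sInf (Subtype.val '' {t : Prim.{u, v} A | a ∈ t.1}), ?_, ?_⟩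
  · have : ((sInf (Subtype.val '' {t : Prim.{u, v} A | a ∈ t.1}) : TwoSidedIdeal A) : Set A) =
        ⋂ t ∈ {t : Prim.{u, v} A | a ∈ t.1}, (t.1 : Set A) := by
      ext b
      rw [SetLike.mem_coe, TwoSidedIdeal.mem_sInf]
      simp only [Set.forall_mem_image, Set.mem_iInter, SetLike.mem_coe]
      exact Iff.rfl
    rw [this]
    refine isClosed_biInter fun t _ => ?_
    obtain ⟨_, ρ, rfl⟩ := t
    exact ρ.isClosed_ker
  · refine Set.Subset.antisymm (fun t ht => show sInf _ ≤ t.1 from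
      sInf_le (Set.mem_image_of_mem _ ht)) fun t ht => ht ?_
    rw [TwoSidedIdeal.mem_sInf]
    rintro _ ⟨s, hs, rfl⟩
    exact hs

namespace IrredRep

/-- A two-sided ideal on which an irreducible representation `π` does not vanish acts without
nonzero null vectors: the vectors annihilated by it form a closed invariant subspace. -/
theorem exists_mul_ne_zero (π : IrredRep.{u, v} A) {I : TwoSidedIdeal A} (hI : ¬ I ≤ π.ker)
    {b : A} (hb : π.toHom b ≠ 0) : ∃ x ∈ I, π.toHom (x * b) ≠ 0 := by
  by_contra! h
  let K : Submodule ℂ π.H := ⨅ x ∈ I, (π.toHom x).ker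
  have hK : ∀ ξ, ξ ∈ K ↔ ∀ x ∈ I, π.toHom x ξ = 0 := by simp [K]
  have hc : IsClosed (K : Set π.H) := by
    have : (K : Set π.H) = ⋂ x ∈ I, ((π.toHom x).ker : Set π.H) := by simp [K]
    rw [this]
    exact isClosed_biInter fun x _ => (π.toHom x).isClosed_ker
  have hi : ∀ a, ∀ ξ ∈ K, π.toHom a ξ ∈ K := by
    intro a ξ hξ
    rw [hK] at hξ ⊢
    intro x hx
    have := hξ (x * a) (I.mul_mem_right _ _ hx)
    rwa [map_mul] at this
  rcases π.irreducible K hc hi with h0 | h0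
  · refine hb (ContinuousLinearMap.ext fun ξ => ?_)
    have : π.toHom b ξ ∈ K := by
      rw [hK]
      intro x hx
      have hxb := h x hx
      rw [map_mul] at hxb
      exact congrArg (fun T => T ξ) hxb
    rw [h0] at this
    simpa using this
  · refine hI fun x hx => mem_ker.2 (ContinuousLinearMap.ext fun ξ => ?_)
    have : ξ ∈ K := h0 ▸ Submodule.mem_top
    exact (hK ξ).1 this x hx

theorem opRank_mul_le (ρ : IrredRep.{u, v} A) (a b : A) : ρ.opRank (a * b) ≤ ρ.opRank b := by
  refine OrderHomClass.mono Cardinal.toENat ?_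
  rw [map_mul]
  exact LinearMap.rank_comp_le_right (ρ.toHom b : ρ.H →ₗ[ℂ] ρ.H) (ρ.toHom a : ρ.H →ₗ[ℂ] ρ.H)

theorem opRank_eq_zero_of_mem_ker {ρ : IrredRep.{u, v} A} {a : A} (h : a ∈ ρ.ker) :
    ρ.opRank a = 0 := by
  rw [opRank, mem_ker.1 h]
  simp

/-- The Fell rank is attained by a local section, the ordinals being well-ordered. -/
theorem fellRank_le_iff {π : IrredRep.{u, v} A} {α : Ordinal.{u}} :
    π.fellRank ≤ α ↔ ∃ s : LocalSection.{u, v} A, π.kerPrim ∈ s.U ∧ s.fellRank ≤ α := by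
  constructor
  · intro h
    have hne : {r | ∃ s : LocalSection.{u, v} A, π.kerPrim ∈ s.U ∧ s.fellRank = r}.Nonempty := by
      rw [Set.nonempty_iff_ne_empty]
      intro h0
      rw [fellRank, h0, sInf_empty] at h
      exact (WithTop.coe_lt_top α).not_ge h
    obtain ⟨s, hs, hr⟩ := csInf_mem hne
    exact ⟨s, hs, hr.trans_le h⟩
  · rintro ⟨s, hs, h⟩
    exact le_trans (b := s.fellRank) (sInf_le ⟨s, hs, rfl⟩) h

end IrredRep

theorem pedersenFun_eq_zero_of_mem {a : A} {t : Prim.{u, v} A} (h : a ∈ t.1) :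
    pedersenFun a t = 0 :=
  IrredRep.opRank_eq_zero_of_mem_ker (t.2.choose_spec.symm ▸ h)

end Spectrum

end FellPedersen

end

theorem mainTheorem5 {A : Type u} [NonUnitalCStarAlgebra A] [TopologicalSpace.SeparableSpace A]
    (π : FellPedersen.IrredRep.{u, v} A) (α : Ordinal.{u}) (hα : α < Ordinal.omega.{u} 1) :
    π.fellRank ≤ α ↔
      ∃ a : A, FellPedersen.pedersenRank.{u, v} a ≤ α ∧ π.toHom a ≠ 0 := by
  open FellPedersen in
  rw [IrredRep.fellRank_le_iff]
  constructor
  · rintro ⟨s, hπ, hs⟩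
    obtain ⟨I, -, hI⟩ := isClosed_prim_iff.1 s.U.isOpen.isClosed_compl
    have hIπ : ¬ I ≤ π.ker := fun h => (hI.symm ▸ h : π.kerPrim ∈ (s.U : Set (Prim A))ᶜ) hπ
    obtain ⟨x, hx, hxb⟩ := π.exists_mul_ne_zero hIπ (s.ne_zero π hπ)
    refine ⟨x * s.b, rank_le_of_le_on_open s.U.isOpen
      (fun t _ => IrredRep.opRank_mul_le _ x s.b) (fun t ht => ?_) hs, hxb⟩
    have hIt : t ∈ hull I := hI ▸ ht
    exact pedersenFun_eq_zero_of_mem (hIt (I.mul_mem_right _ _ hx))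
  · rintro ⟨a, ha, hπ⟩
    refine ⟨⟨a, ⟨{t | a ∈ t.1}ᶜ, (isClosed_setOf_mem_prim a).isOpen_compl⟩,
      fun ρ hρ h => hρ (IrredRep.mem_ker.2 h)⟩, fun h => hπ (IrredRep.mem_ker.1 h), ?_⟩
    exact rank_comp_le continuous_subtype_val ha
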